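/- Let $K$ be a field, $S=K[x_1,\ldots,x_n]$ the standard graded polynomial ring, and $k\ge 1$ an integer. A monomial is called $k$-bounded if all its exponents are at most $k$. An ideal $I\subseteq S$ generated by $k$-bounded monomials is called $k$-Borel if for every $k$-bounded monomial $u\in I$, every $j$ with $x_j\mid u$ and every $i<j$, the monomial $x_i(u/x_j)$ lies in $I$ whenever it is $k$-bounded. Let $G(I)$ denote the unique minimal set of monomial generators of $I$, and let $\beta_{i,t}(I)$ denote the graded Betti numbers of $I$: the ideal $I$ has a minimal graded free resolution over $S$ by finitely generated free modules, and $\beta_{i,t}(I)$ is the number of summands $S(-t)$ of the $i$-th free module of any such resolution. If $I$ is a $k$-Borel ideal, then for all integers $i\ge 0$ and all $j\in\mathbb{Z}$ \[ \beta_{i,i+j}(I)=\sum_{u\in G(I),\ \deg(u)=j}\binom{m(u)-L(u)-1}{i}, \] where $m(u)=\max\{\ell : x_\ell\mid u\}$ and $L(u)=|\{1\le \ell<m(u) : \deg_{x_\ell}(u)=k\}|$, with $\deg_{x_\ell}(u)$ the exponent of $x_\ell$ in $u$. (In the trivial case $I=S$, where $G(I)=\{1\}$ and $m(1)$ is undefined,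 the binomial coefficient for $u=1$ is read as $\binom{0}{i}$.) -/

import Mathlib

open MvPolynomial

noncomputable section

namespace KBorel

/-! Monomials of `S = K[x_1, …, x_n]` are given by exponent vectors `u : Fin n →₀ ℕ`; the variable
`x_ℓ` (`1 ≤ ℓ ≤ n`) is `X i` with `i : Fin n` and `ℓ = i + 1`. -/

/-- The monomial `u` is `k`-bounded: all its exponents are at most `k`. -/
def IsBounded {n : ℕ} (k : ℕ) (u : Fin n →₀ ℕ) : Prop := ∀ i, u i ≤ k

/-- `I` is a `k`-bounded monomial ideal: it is generated by a set of `k`-bounded monomials. -/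
def IsBoundedMonomialIdeal {n : ℕ} {K : Type*} [Field K] (k : ℕ)
    (I : Ideal (MvPolynomial (Fin n) K)) : Prop :=
  ∃ A : Set (Fin n →₀ ℕ), (∀ u ∈ A, IsBounded k u) ∧
    I = Ideal.span ((fun u => monomial u (1 : K)) '' A)

/-- `I` is a `k`-Borel ideal: it is a `k`-bounded monomial ideal and, for each `k`-bounded monomial
`u ∈ I`, each `j ∈ supp u` and each `i < j`, the monomial `x_i (u / x_j)` belongs to `I` provided
that it is `k`-bounded. -/
def IsKBorel {n : ℕ} {K : Type*} [Field K] (k : ℕ)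
    (I : Ideal (MvPolynomial (Fin n) K)) : Prop :=
  IsBoundedMonomialIdeal k I ∧
    ∀ u : Fin n →₀ ℕ, IsBounded k u → monomial u (1 : K) ∈ I →
      ∀ j ∈ u.support, ∀ i < j,
        IsBounded k (Finsupp.single i 1 + (u - Finsupp.single j 1)) →
          monomial (Finsupp.single i 1 + (u - Finsupp.single j 1)) (1 : K) ∈ I

/-- `G(I)` as a set: the monomials of `I` that are minimal with respect to divisibility. -/
def minGenSet {n : ℕ} {K : Type*} [Field K] (I : Ideal (MvPolynomial (Fin n) K)) :
    Set (Fin n →₀ ℕ) :=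
  {u | Minimal (fun v => monomial v (1 : K) ∈ I) u}

theorem minGenSet_finite {n : ℕ} {K : Type*} [Field K] (I : Ideal (MvPolynomial (Fin n) K)) :
    (minGenSet I).Finite := by
  have hanti : IsAntichain (· ≤ ·) (minGenSet I) := by
    intro u hu v hv huv h
    exact huv (le_antisymm h (hv.2 hu.1 h))
  exact WellQuasiOrderedLE.finite_of_isAntichain hanti

/-- `G(I)`, the minimal set of monomial generators of a monomial ideal `I`. -/
def minGens {n : ℕ} {K : Type*} [Field K] (I : Ideal (MvPolynomial (Fin n) K)) :
    Finset (Fin n →₀ ℕ) :=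
  (minGenSet_finite I).toFinset

/-- `m(u) = max {ℓ : x_ℓ ∣ u}`, where variables are numbered from `1` (and `m(1) = 0`). -/
def maxIndex {n : ℕ} (u : Fin n →₀ ℕ) : ℕ := u.support.sup fun i => (i : ℕ) + 1

/-- `L(u)`: the number of `1 ≤ ℓ < m(u)` such that the exponent of `x_ℓ` in `u` is `k`. -/
def fullCount {n : ℕ} (k : ℕ) (u : Fin n →₀ ℕ) : ℕ :=
  (Finset.univ.filter fun i : Fin n => (i : ℕ) + 1 < maxIndex u ∧ u i = k).card

/-- In the graded free module `⊕_b S(-s b)` with basis indexed by `Fin r`, the element `v` is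
homogeneous of degree `t`: each monomial that occurs in the coordinate `v b` has degree `t - s b`.
(Zero is homogeneous of every degree.) -/
def IsHomogeneousVec {n : ℕ} {K : Type*} [Field K] {r : ℕ} (s : Fin r → ℤ) (t : ℤ)
    (v : Fin r → MvPolynomial (Fin n) K) : Prop :=
  ∀ b, ∀ w ∈ (v b).support, ((Finsupp.degree w : ℕ) : ℤ) + s b = t

/-- A minimal graded free resolution `⋯ → F_1 → F_0 → I → 0` of the ideal `I` of
`S = K[x_1, …, x_n]`, with `S` standard graded, by finitely generated graded free modules
`F_i = ⊕_b S(-shift i b)`. -/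
structure MinimalGradedFreeResolution {n : ℕ} {K : Type*} [Field K]
    (I : Ideal (MvPolynomial (Fin n) K)) where
  /-- The rank of `F_i`. -/
  rank : ℕ → ℕ
  /-- The degree of the basis element `b` of `F_i`. -/
  shift : (i : ℕ) → Fin (rank i) → ℤ
  /-- The augmentation `F_0 → I`. -/
  aug : (Fin (rank 0) → MvPolynomial (Fin n) K) →ₗ[MvPolynomial (Fin n) K] I
  /-- The differential `F_{i+1} → F_i`. -/
  d : (i : ℕ) → (Fin (rank (i + 1)) → MvPolynomial (Fin n) K) →ₗ[MvPolynomial (Fin n) K]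
    (Fin (rank i) → MvPolynomial (Fin n) K)
  /-- The augmentation has degree zero. -/
  aug_homogeneous : ∀ b, ∀ w ∈ (aug (Pi.single b 1) : MvPolynomial (Fin n) K).support,
    ((Finsupp.degree w : ℕ) : ℤ) = shift 0 b
  /-- The differentials have degree zero. -/
  d_homogeneous : ∀ i b, IsHomogeneousVec (shift i) (shift (i + 1) b) (d i (Pi.single b 1))
  /-- Exactness at `I`. -/
  aug_surjective : Function.Surjective aug
  /-- Exactness at `F_0`. -/
  exact_zero : Function.Exact (d 0) aug
  /-- Exactness at `F_{i+1}`. -/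
  exact_succ : ∀ i, Function.Exact (d (i + 1)) (d i)
  /-- Minimality: the image of `F_{i+1}` lies in `(x_1, …, x_n) F_i`. -/
  minimal : ∀ i, LinearMap.range (d i) ≤
    Ideal.span (Set.range (X : Fin n → MvPolynomial (Fin n) K)) •
      (⊤ : Submodule (MvPolynomial (Fin n) K) (Fin (rank i) → MvPolynomial (Fin n) K))

/-- The graded Betti number read off from a minimal graded free resolution: the number of basis
elements of degree `t` of `F_i`, that is, of summands `S(-t)` of `F_i`. -/
def MinimalGradedFreeResolution.betti {n : ℕ} {K : Type*} [Field K]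
    {I : Ideal (MvPolynomial (Fin n) K)} (F : MinimalGradedFreeResolution I) (i : ℕ) (t : ℤ) : ℕ :=
  (Finset.univ.filter fun b : Fin (F.rank i) => F.shift i b = t).card

end KBorel

end

/-! Order the minimal generators by degree and then by the weight `∑ ℓ u_ℓ`, with ties broken
arbitrarily. In this order the ideal has linear quotients: if `J` is spanned by the generators
before `u`, then `J : u` is generated by the variables `x_ℓ` with `ℓ < m(u)` whose exponent in `u`
is less than `k` (`IsKBorel.mem_span_freeVars_iff`), and there are `m(u) - L(u) - 1` of them
(`card_freeVars`).

Adjoining `u` to `J` is therefore a mapping cone of a Koszul-type resolution, shifted by `deg u`,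
over the resolution of `S ⧸ J` (`exists_cone`, `exists_variables`). Degrees do not decrease along
the order, so the comparison map has no nonzero constant entry in positive homological degree. Hence
the cone stays minimal and the Betti numbers add up to the sum of binomials.

Every minimal resolution gives the same numbers (`betti_eq`), because comparison maps over the
identity are inverse to each other modulo the variables. All of this is done for `S ⧸ I`, so
homological degree `i` for `I` is `i + 1` there. -/

noncomputable section

namespace KBorel

variable {n : ℕ} {K : Type*} [Field K] {k : ℕ}

local notation "S" => MvPolynomial (Fin n) K

/-! ### Homogeneous vectors and maps between graded free modules. -/

/-- The element `v` of the graded free module `⊕_b S(-s b)` is homogeneous of degree `t`. -/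
def HomogVec {α : Type} (s : α → ℤ) (t : ℤ) (v : α → S) : Prop :=
  ∀ b, ∀ w ∈ (v b).support, ((Finsupp.degree w : ℕ) : ℤ) + s b = t

/-- The linear map `f` is homogeneous of degree zero: each term of `f v` has the degree of a term
of `v`. -/
def HomogMap {α β : Type} (s : α → ℤ) (s' : β → ℤ) (f : (α → S) →ₗ[S] (β → S)) : Prop :=
  ∀ v a, ∀ m ∈ (f v a).support, ∃ b, ∃ w ∈ (v b).support,
    ((Finsupp.degree w : ℕ) : ℤ) + s b = ((Finsupp.degree m : ℕ) : ℤ) + s' a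

section HomogMap

variable {α β γ : Type} {s : α → ℤ} {s' : β → ℤ} {s'' : γ → ℤ}

theorem HomogMap.homogVec {f : (α → S) →ₗ[S] (β → S)} (hf : HomogMap s s' f) {t : ℤ}
    {v : α → S} (hv : HomogVec s t v) : HomogVec s' t (f v) := by
  intro a m hm
  obtain ⟨b, w, hw, h⟩ := hf v a m hm
  rw [← h, hv b w hw]

theorem HomogMap.comp {g : (β → S) →ₗ[S] (γ → S)} {f : (α → S) →ₗ[S] (β → S)}
    (hg : HomogMap s' s'' g) (hf : HomogMap s s' f) : HomogMap s s'' (g ∘ₗ f) := by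
  intro v a m hm
  obtain ⟨b, w, hw, h⟩ := hg (f v) a m hm
  obtain ⟨c, x, hx, h'⟩ := hf v b w hw
  exact ⟨c, x, hx, h'.trans h⟩

theorem HomogMap.add_const {f : (α → S) →ₗ[S] (β → S)} (hf : HomogMap s s' f) (c : ℤ) :
    HomogMap (fun b => s b + c) (fun a => s' a + c) f := by
  intro v a m hm
  obtain ⟨b, w, hw, h⟩ := hf v a m hm
  exact ⟨b, w, hw, by linarith⟩

/-- A nonzero constant entry has degree zero, so it can only join basis elements of equal degree.
Both the minimality of cones and the invariance of Betti numbers rest on this. -/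
theorem HomogMap.constantCoeff_eq_zero [DecidableEq α] {f : (α → S) →ₗ[S] (β → S)}
    (hf : HomogMap s s' f) {a : β} {b : α} (h : s' a ≠ s b) :
    constantCoeff (f (Pi.single b 1) a) = 0 := by
  by_contra h0
  obtain ⟨c, w, hw, h'⟩ := hf (Pi.single b 1) a 0 (by
    rwa [mem_support_iff, ← constantCoeff_eq])
  rcases eq_or_ne c b with rfl | hcb
  · rw [Pi.single_eq_same, mem_support_iff, coeff_one] at hw
    have hw0 : w = 0 := by
      by_contra hne
      exact hw (if_neg (Ne.symm hne))
    subst hw0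
    simp at h'
    exact h h'.symm
  · rw [Pi.single_eq_of_ne hcb] at hw
    simp at hw

theorem homogVec_single [DecidableEq α] (b : α) : HomogVec s (s b) (Pi.single b (1 : S)) := by
  intro c w hw
  rcases eq_or_ne c b with rfl | hcb
  · rw [Pi.single_eq_same, mem_support_iff, coeff_one] at hw
    have hw0 : w = 0 := by
      by_contra hne
      exact hw (if_neg (Ne.symm hne))
    simp [hw0]
  · rw [Pi.single_eq_of_ne hcb] at hw
    simp at hw

theorem homogMap_linearCombination [Fintype α] {h : α → β → S}
    (hh : ∀ b, HomogVec s' (s b) (h b)) : HomogMap s s' (Fintype.linearCombination S h) := by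
  classical
  intro v a m hm
  rw [Fintype.linearCombination_apply, Finset.sum_apply] at hm
  obtain ⟨b, -, hb⟩ : ∃ b ∈ Finset.univ, m ∈ ((v b • h b) a).support := by
    simpa using support_sum hm
  rw [Pi.smul_apply, smul_eq_mul] at hb
  obtain ⟨x, hx, y, hy, rfl⟩ := Finset.mem_add.1 (support_mul _ _ hb)
  refine ⟨b, x, hx, ?_⟩
  have := hh b a y hy
  rw [map_add]
  push_cast
  linarith

theorem linearCombination_apply_single [Fintype α] [DecidableEq α]
    (f : (α → S) →ₗ[S] (β → S)) :
    Fintype.linearCombination S (fun b => f (Pi.single b 1)) = f := by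
  apply LinearMap.pi_ext
  intro b x
  rw [Fintype.linearCombination_apply_single, ← map_smul]
  congr 1
  ext c
  rcases eq_or_ne c b with rfl | hcb
  · simp
  · simp [hcb]

theorem homogMap_of_single [Fintype α] [DecidableEq α] {f : (α → S) →ₗ[S] (β → S)}
    (hf : ∀ b, HomogVec s' (s b) (f (Pi.single b 1))) : HomogMap s s' f := by
  rw [← linearCombination_apply_single f]
  exact homogMap_linearCombination hf

/-- The degree is an integer because it is used as `t - s b`, which may be negative; the part is
then zero. -/
theorem exists_homogeneous_part (p : S) (t : ℤ) :
    ∃ q : S, ∀ m, coeff m q = if ((Finsupp.degree m : ℕ) : ℤ) = t then coeff m p else 0 := by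
  rcases lt_or_ge t 0 with ht | ht
  · refine ⟨0, fun m => ?_⟩
    rw [if_neg (by omega), coeff_zero]
  · lift t to ℕ using ht
    refine ⟨homogeneousComponent t p, fun m => ?_⟩
    simp [coeff_homogeneousComponent]

/-- Keep only the degree `t` part `w₁` of a preimage `w`. In degree `t` the difference `w - w₁`
contributes nothing, and outside degree `t` both images vanish. -/
theorem HomogMap.exists_homogVec {g : (α → S) →ₗ[S] (β → S)} (hg : HomogMap s s' g) {t : ℤ}
    {v : β → S} (hv : HomogVec s' t v) (hmem : v ∈ LinearMap.range g) :
    ∃ w, HomogVec s t w ∧ g w = v := by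
  obtain ⟨w, rfl⟩ := hmem
  choose w₁ hw₁ using fun b => exists_homogeneous_part (w b) (t - s b)
  have h₁ : HomogVec s t w₁ := by
    intro b m hm
    rw [mem_support_iff, hw₁] at hm
    split_ifs at hm with h
    · linarith
    · exact absurd rfl hm
  refine ⟨w₁, h₁, ?_⟩
  funext a
  ext m
  by_cases ht : ((Finsupp.degree m : ℕ) : ℤ) + s' a = t
  · by_contra hne
    obtain ⟨b, x, hx, h⟩ := hg (w - w₁) a m (by
      rw [mem_support_iff, map_sub, Pi.sub_apply, coeff_sub, sub_ne_zero]
      exact Ne.symm hne)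
    rw [mem_support_iff, Pi.sub_apply, coeff_sub, hw₁, if_pos (by linarith)] at hx
    exact hx (sub_self _)
  · have e₁ : coeff m (g w a) = 0 := by
      by_contra h
      exact ht (hv a m (mem_support_iff.2 h))
    have e₂ : coeff m (g w₁ a) = 0 := by
      by_contra h
      exact ht (hg.homogVec h₁ a m (mem_support_iff.2 h))
    rw [e₁, e₂]

theorem HomogMap.exists_lift [Fintype α] {f : (α → S) →ₗ[S] (γ → S)}
    {g : (β → S) →ₗ[S] (γ → S)} (hf : HomogMap s s'' f) (hg : HomogMap s' s'' g)
    (hfg : ∀ v, f v ∈ LinearMap.range g) :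
    ∃ h : (α → S) →ₗ[S] (β → S), HomogMap s s' h ∧ ∀ v, g (h v) = f v := by
  classical
  choose h hh hgh using fun b => hg.exists_homogVec (hf.homogVec (homogVec_single b)) (hfg _)
  refine ⟨Fintype.linearCombination S h, homogMap_linearCombination hh, fun v => ?_⟩
  conv_rhs => rw [← linearCombination_apply_single f]
  simp [Fintype.linearCombination_apply, hgh]

/-- The ungraded lifting suffices for homotopies, whose degrees play no role. -/
theorem exists_lift [Fintype α] (f : (α → S) →ₗ[S] (γ → S)) (g : (β → S) →ₗ[S] (γ → S))
    (hfg : ∀ v, f v ∈ LinearMap.range g) :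
    ∃ h : (α → S) →ₗ[S] (β → S), ∀ v, g (h v) = f v := by
  classical
  choose h hgh using fun b => hfg (Pi.single b 1)
  refine ⟨Fintype.linearCombination S h, fun v => ?_⟩
  conv_rhs => rw [← linearCombination_apply_single f]
  simp [Fintype.linearCombination_apply, hgh]

/-- Modulo the variables, `f` acts as a matrix over `K`. -/
theorem constantCoeff_apply_eq_sum [Fintype α] [DecidableEq α] (f : (α → S) →ₗ[S] (β → S))
    (v : α → S) (a : β) :
    constantCoeff (f v a) =
      ∑ b, constantCoeff (v b) * constantCoeff (f (Pi.single b 1) a) := by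
  conv_lhs => rw [← linearCombination_apply_single f]
  simp [Fintype.linearCombination_apply]

end HomogMap

/-- Chain maps and homotopies are built degree by degree. The next term exists only under the
invariant `P`, which is carried along. -/
theorem exists_dependent_seq {X : ℕ → Type*} (P : ∀ i, X i → Prop)
    (R : ∀ i, X i → X (i + 1) → Prop) (x₀ : X 0) (h₀ : P 0 x₀)
    (step : ∀ i x, P i x → ∃ y, P (i + 1) y ∧ R i x y) :
    ∃ f : ∀ i, X i, f 0 = x₀ ∧ (∀ i, P i (f i)) ∧ ∀ i, R i (f i) (f (i + 1)) := by
  choose g hg hR using step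
  let F : ∀ i, {x : X i // P i x} :=
    fun i => Nat.rec ⟨x₀, h₀⟩ (fun i x => ⟨g i x.1 x.2, hg i x.1 x.2⟩) i
  exact ⟨fun i => (F i).1, rfl, fun i => (F i).2, fun i => hR i (F i).1 (F i).2⟩

/-! ### Resolutions of `S ⧸ I` and the invariance of Betti numbers. -/

/-- A graded free resolution of `S ⧸ I` by finite free modules, starting with `S` in degree zero,
whose differentials are minimal except possibly for the first one, which has image `I`. -/
structure QuotientResolution (I : Ideal S) where
  /-- The basis of the `i`-th module. -/
  ι : ℕ → Type
  /-- The bases are finite. -/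
  [fintype : ∀ i, Fintype (ι i)]
  /-- The degrees of the basis elements. -/
  shift : ∀ i, ι i → ℤ
  /-- The differentials. -/
  d : ∀ i, (ι (i + 1) → S) →ₗ[S] (ι i → S)
  /-- The module in degree zero has rank one. -/
  root : ι 0
  eq_root : ∀ a, a = root
  shift_root : shift 0 root = 0
  mem_range_zero : ∀ v, v ∈ LinearMap.range (d 0) ↔ v root ∈ I
  homog : ∀ i, HomogMap (shift (i + 1)) (shift i) (d i)
  exact : ∀ i, Function.Exact (d (i + 1)) (d i)
  minimal : ∀ i v a, constantCoeff (d (i + 1) v a) = 0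

attribute [instance] QuotientResolution.fintype

namespace QuotientResolution

/-- The number of basis elements of degree `t` of the `i`-th module. -/
def betti {I : Ideal S} (C : QuotientResolution I) (i : ℕ) (t : ℤ) : ℕ :=
  (Finset.univ.filter fun b : C.ι i => C.shift i b = t).card

/-- Multiplication by a homogeneous `u` with `u I ⊆ J` lifts to a homogeneous chain map of
resolutions. -/
theorem exists_chainMap {I J : Ideal S} (C : QuotientResolution I) (D : QuotientResolution J)
    (u : S) (c : ℕ) (hu : u.IsHomogeneous c) (huI : ∀ f ∈ I, u * f ∈ J) :
    ∃ φ : ∀ i, (C.ι i → S) →ₗ[S] (D.ι i → S),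
      (∀ v, φ 0 v D.root = u * v C.root) ∧
      (∀ i, HomogMap (fun b => C.shift i b + c) (D.shift i) (φ i)) ∧
      ∀ i v, D.d i (φ (i + 1) v) = φ i (C.d i v) := by
  classical
  let φ₀ : (C.ι 0 → S) →ₗ[S] (D.ι 0 → S) :=
    LinearMap.pi fun _ => u • LinearMap.proj C.root
  have hφ₀ : ∀ v a, φ₀ v a = u * v C.root := fun v a => rfl
  obtain ⟨φ, h0, hP, hR⟩ := exists_dependent_seq
    (X := fun i => (C.ι i → S) →ₗ[S] (D.ι i → S))
    -- The second half of the invariant is what the next lift needs: `φ ∘ d` lands in the image of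
    -- the differential of `D`.
    (fun i φ => HomogMap (fun b => C.shift i b + c) (D.shift i) φ ∧
      ∀ v, φ (C.d i v) ∈ LinearMap.range (D.d i))
    (fun i φ ψ => ∀ v, D.d i (ψ v) = φ (C.d i v)) φ₀
    ⟨fun v a m hm => by
      rw [hφ₀] at hm
      obtain ⟨x, hx, y, hy, rfl⟩ := Finset.mem_add.1 (support_mul _ _ hm)
      refine ⟨C.root, y, hy, ?_⟩
      have hx' : Finsupp.degree x = c := by
        have := hu (mem_support_iff.1 hx)
        rw [Finsupp.degree_eq_weight_one]
        exact this
      simp only [D.eq_root a, D.shift_root, C.shift_root, map_add, hx']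
      push_cast
      ring, fun v => by
      rw [D.mem_range_zero, hφ₀]
      exact huI _ ((C.mem_range_zero _).1 ⟨v, rfl⟩)⟩
    (by
      rintro i φ ⟨hφ, hr⟩
      obtain ⟨ψ, hψ, hψ'⟩ := HomogMap.exists_lift
        (f := φ ∘ₗ C.d i) (hφ.comp ((C.homog i).add_const c)) (D.homog i) hr
      refine ⟨ψ, ⟨hψ, fun v => ?_⟩, hψ'⟩
      refine (D.exact i _).1 ?_
      rw [hψ', LinearMap.comp_apply, (C.exact i).apply_apply_eq_zero, map_zero])
  exact ⟨φ, fun v => by rw [h0, hφ₀], fun i => (hP i).1, hR⟩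

/-- Two chain maps lifting the identity are inverse to each other modulo the variables. -/
theorem constantCoeff_comp_chainMap {I J : Ideal S} (C : QuotientResolution I)
    (D : QuotientResolution J)
    (φ : ∀ i, (C.ι i → S) →ₗ[S] (D.ι i → S)) (ψ : ∀ i, (D.ι i → S) →ₗ[S] (C.ι i → S))
    (hφ₀ : ∀ v, φ 0 v D.root = v C.root) (hψ₀ : ∀ v, ψ 0 v C.root = v D.root)
    (hφ : ∀ i v, D.d i (φ (i + 1) v) = φ i (C.d i v))
    (hψ : ∀ i v, C.d i (ψ (i + 1) v) = ψ i (D.d i v)) (i : ℕ) (v : C.ι (i + 1) → S)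
    (a : C.ι (i + 1)) :
    constantCoeff (ψ (i + 1) (φ (i + 1) v) a) = constantCoeff (v a) := by
  classical
  have key₀ : ∀ v, ψ 0 (φ 0 v) = v := by
    intro v
    funext a
    rw [C.eq_root a, hψ₀, hφ₀]
  obtain ⟨h, h0, -, hR⟩ := exists_dependent_seq
    (X := fun i => (C.ι i → S) →ₗ[S] (C.ι (i + 1) → S))
    (fun i h => ∀ v, C.d i (ψ (i + 1) (φ (i + 1) v) - v - h (C.d i v)) = 0)
    -- The `h i` form a homotopy from the identity to `ψ ∘ φ`. It starts at zero because the
    -- composite is exactly the identity in degree zero, so the possibly non-minimal first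
    -- differential never contributes.
    (fun i h h' => ∀ v, C.d (i + 1) (h' v) = ψ (i + 1) (φ (i + 1) v) - v - h (C.d i v)) 0
    (by
      intro v
      simp [hψ, hφ, key₀])
    (by
      intro i h hh
      obtain ⟨h', hh'⟩ := exists_lift
        (ψ (i + 1) ∘ₗ φ (i + 1) - LinearMap.id - h ∘ₗ C.d i) (C.d (i + 1))
        (fun v => (C.exact i _).1 (hh v))
      refine ⟨h', fun v => ?_, hh'⟩
      rw [map_sub, hh', map_sub, hψ, hφ]
      simp [(C.exact i).apply_apply_eq_zero])
  have e : ψ (i + 1) (φ (i + 1) v) = v + C.d (i + 1) (h (i + 1) v) + h i (C.d i v) := by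
    rw [hR]; abel
  have e0 : constantCoeff (h i (C.d i v) a) = 0 := by
    cases i with
    | zero => simp [h0]
    | succ i =>
      rw [constantCoeff_apply_eq_sum]
      exact Finset.sum_eq_zero fun b _ => by rw [C.minimal, zero_mul]
  rw [e, Pi.add_apply, Pi.add_apply, map_add, map_add, C.minimal, e0, add_zero, add_zero]

/-- The constant terms of the comparison maps between basis elements of degree `t` form matrices `A`
and `B` with `B * A = 1`, so `A` is injective and the dimensions compare. -/
theorem betti_le {I : Ideal S} (C D : QuotientResolution I) (i : ℕ) (t : ℤ) :
    C.betti (i + 1) t ≤ D.betti (i + 1) t := by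
  classical
  obtain ⟨φ, hφ₀, hφh, hφ⟩ := C.exists_chainMap D 1 0 (isHomogeneous_one _ _) (by simp)
  obtain ⟨ψ, hψ₀, -, hψ⟩ := D.exists_chainMap C 1 0 (isHomogeneous_one _ _) (by simp)
  have hcomp := constantCoeff_comp_chainMap C D φ ψ (by simpa using hφ₀) (by simpa using hψ₀) hφ hψ i
  let A : Matrix {b // D.shift (i + 1) b = t} {b // C.shift (i + 1) b = t} K :=
    fun c b => constantCoeff (φ (i + 1) (Pi.single b.1 1) c.1)
  let B : Matrix {b // C.shift (i + 1) b = t} {b // D.shift (i + 1) b = t} K :=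
    fun a c => constantCoeff (ψ (i + 1) (Pi.single c.1 1) a.1)
  have hBA : B * A = 1 := by
    ext a b
    have h1 := hcomp (Pi.single b.1 1) a.1
    rw [constantCoeff_apply_eq_sum] at h1
    rw [Matrix.mul_apply]
    have h2 : ∑ c : {c // D.shift (i + 1) c = t}, B a c * A c b =
        ∑ c, constantCoeff (φ (i + 1) (Pi.single b.1 1) c) *
          constantCoeff (ψ (i + 1) (Pi.single c 1) a.1) := by
      let f : D.ι (i + 1) → K := fun c => constantCoeff (φ (i + 1) (Pi.single b.1 1) c) *
        constantCoeff (ψ (i + 1) (Pi.single c 1) a.1)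
      have e₁ : ∑ c : {c // D.shift (i + 1) c = t}, B a c * A c b =
          ∑ c : {c // D.shift (i + 1) c = t}, f c.1 :=
        Finset.sum_congr rfl fun c _ => mul_comm _ _
      rw [e₁, ← Finset.sum_subtype (Finset.univ.filter fun c => D.shift (i + 1) c = t) (by simp) f]
      -- Basis elements of other degrees add nothing, since constant entries preserve degree.
      refine Finset.sum_subset (Finset.filter_subset _ _) fun c _ hc => ?_
      have hc' : D.shift (i + 1) c ≠ t := by simpa using hc
      have := (hφh (i + 1)).constantCoeff_eq_zero (a := c) (b := b.1) (by
        rw [b.2]; simpa using hc')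
      simp only [f, this, zero_mul]
    rw [h2, h1, Matrix.one_apply]
    by_cases hab : a = b
    · simp [hab]
    · rw [if_neg hab, Pi.single_eq_of_ne (fun h => hab (Subtype.ext h)), map_zero]
  have hinj : Function.Injective A.mulVecLin := by
    intro v w hvw
    have := congrArg B.mulVec hvw
    simpa [Matrix.mulVec_mulVec, hBA] using this
  have := LinearMap.finrank_le_finrank_of_injective hinj
  simpa [betti, Fintype.card_subtype] using this

theorem betti_eq {I : Ideal S} (C D : QuotientResolution I) (i : ℕ) (t : ℤ) :
    C.betti (i + 1) t = D.betti (i + 1) t :=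
  le_antisymm (betti_le C D i t) (betti_le D C i t)

end QuotientResolution

/-! ### Mapping cones and the resolution of an ideal of variables. -/

namespace QuotientResolution

/-- The resolution of `S ⧸ 0`. -/
def bot : QuotientResolution (⊥ : Ideal S) where
  ι i := Nat.casesOn i Unit fun _ => Empty
  fintype i := match i with
    | 0 => inferInstanceAs (Fintype Unit)
    | _ + 1 => inferInstanceAs (Fintype Empty)
  shift _ _ := 0
  d _ := 0
  root := ()
  eq_root _ := rfl
  shift_root := rfl
  mem_range_zero v := by
    rw [LinearMap.range_zero, Submodule.mem_bot, Ideal.mem_bot]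
    exact ⟨fun h => by rw [h]; rfl, fun h => funext fun _ => h⟩
  homog _ v a m hm := by simp at hm
  exact i v := ⟨fun _ => ⟨0, funext fun a => a.elim⟩, fun _ => by simp⟩
  minimal i v a := by simp

theorem bot_betti_succ (i : ℕ) (t : ℤ) :
    (bot : QuotientResolution (⊥ : Ideal S)).betti (i + 1) t = 0 := by
  rw [betti, Finset.card_eq_zero, Finset.filter_eq_empty_iff]
  exact fun b => b.elim

section Cone

variable {α β γ δ : Type}

/-- The map `(p, q) ↦ f p + g q`. -/
def coneZero (f : (α → S) →ₗ[S] (β → S)) (g : (γ → S) →ₗ[S] (β → S)) :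
    (α ⊕ γ → S) →ₗ[S] (β → S) :=
  f ∘ₗ LinearMap.funLeft S S Sum.inl + g ∘ₗ LinearMap.funLeft S S Sum.inr

/-- The map `(p, q) ↦ (f p + g q, - h q)`. -/
def coneSucc (f : (α → S) →ₗ[S] (β → S)) (g : (γ → S) →ₗ[S] (β → S))
    (h : (γ → S) →ₗ[S] (δ → S)) : (α ⊕ γ → S) →ₗ[S] (β ⊕ δ → S) :=
  LinearMap.pi (Sum.elim (fun b => LinearMap.proj b ∘ₗ coneZero f g)
    (fun c => - (LinearMap.proj c ∘ₗ h ∘ₗ LinearMap.funLeft S S Sum.inr)))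

theorem coneZero_apply (f : (α → S) →ₗ[S] (β → S)) (g : (γ → S) →ₗ[S] (β → S))
    (v : α ⊕ γ → S) : coneZero f g v = f (v ∘ Sum.inl) + g (v ∘ Sum.inr) := rfl

theorem coneSucc_apply (f : (α → S) →ₗ[S] (β → S)) (g : (γ → S) →ₗ[S] (β → S))
    (h : (γ → S) →ₗ[S] (δ → S)) (v : α ⊕ γ → S) :
    coneSucc f g h v = Sum.elim (f (v ∘ Sum.inl) + g (v ∘ Sum.inr)) (- h (v ∘ Sum.inr)) := by
  funext a
  cases a <;> rfl

variable {s : α → ℤ} {s' : β → ℤ} {r : γ → ℤ} {r' : δ → ℤ}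

theorem homogMap_coneZero {f : (α → S) →ₗ[S] (β → S)} {g : (γ → S) →ₗ[S] (β → S)}
    (hf : HomogMap s s' f) (hg : HomogMap r s' g) :
    HomogMap (Sum.elim s r) s' (coneZero f g) := by
  classical
  intro v a m hm
  rw [coneZero_apply, Pi.add_apply] at hm
  rcases Finset.mem_union.1 (support_add hm) with hm | hm
  · obtain ⟨b, w, hw, h⟩ := hf _ a m hm
    exact ⟨Sum.inl b, w, hw, h⟩
  · obtain ⟨b, w, hw, h⟩ := hg _ a m hm
    exact ⟨Sum.inr b, w, hw, h⟩

theorem homogMap_coneSucc {f : (α → S) →ₗ[S] (β → S)} {g : (γ → S) →ₗ[S] (β → S)}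
    {h : (γ → S) →ₗ[S] (δ → S)} (hf : HomogMap s s' f) (hg : HomogMap r s' g)
    (hh : HomogMap r r' h) : HomogMap (Sum.elim s r) (Sum.elim s' r') (coneSucc f g h) := by
  intro v a m hm
  cases a with
  | inl a => exact homogMap_coneZero hf hg v a m hm
  | inr a =>
    rw [coneSucc_apply, Sum.elim_inr, Pi.neg_apply, support_neg] at hm
    obtain ⟨b, w, hw, h⟩ := hh _ a m hm
    exact ⟨Sum.inr b, w, hw, h⟩

end Cone

/-- The mapping cone of the multiplication `S ⧸ (J : u) → S ⧸ J` by a homogeneous element `u`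
resolves `S ⧸ (J + (u))`. -/
theorem exists_cone {J Q : Ideal S} (P : QuotientResolution J) (R : QuotientResolution Q)
    (u : S) (c : ℕ) (hu : u.IsHomogeneous c) (hQ : ∀ f, f ∈ Q ↔ u * f ∈ J)
    (hQm : ∀ f ∈ Q, constantCoeff f = 0)
    (hdeg : ∀ i a b, P.shift (i + 1) a < R.shift (i + 1) b + c) :
    ∃ C : QuotientResolution (J ⊔ Ideal.span {u}),
      (∀ i t, C.betti (i + 1) t = P.betti (i + 1) t + R.betti i (t - c)) ∧
      ∀ i b, (∃ a, C.shift (i + 1) b = P.shift (i + 1) a) ∨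
        ∃ a, C.shift (i + 1) b = R.shift i a + c := by
  classical
  obtain ⟨φ, hφ₀, hφh, hφ⟩ := R.exists_chainMap P u c hu (fun f hf => (hQ f).1 hf)
  have hθ : ∀ i v a, constantCoeff (φ (i + 1) v a) = 0 := by
    intro i v a
    rw [constantCoeff_apply_eq_sum]
    refine Finset.sum_eq_zero fun b _ => ?_
    rw [(hφh (i + 1)).constantCoeff_eq_zero (hdeg i a b).ne, mul_zero]
  -- The first differential of `R` also becomes part of a higher differential of the cone; it is
  -- minimal because `Q` contains no element with a constant term.
  have hRmin : ∀ i v a, constantCoeff (R.d i v a) = 0 := by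
    intro i v a
    cases i with
    | zero =>
      rw [R.eq_root a]
      exact hQm _ ((R.mem_range_zero _).1 ⟨v, rfl⟩)
    | succ i => exact R.minimal i v a
  let C : QuotientResolution (J ⊔ Ideal.span {u}) :=
    { ι := fun i => Nat.casesOn i (P.ι 0) fun i => P.ι (i + 1) ⊕ R.ι i
      fintype := fun i => match i with
        | 0 => inferInstanceAs (Fintype (P.ι 0))
        | i + 1 => inferInstanceAs (Fintype (P.ι (i + 1) ⊕ R.ι i))
      shift := fun i => match i with
        | 0 => P.shift 0
        | i + 1 => Sum.elim (P.shift (i + 1)) (fun b => R.shift i b + c)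
      d := fun i => match i with
        | 0 => coneZero (P.d 0) (φ 0)
        | i + 1 => coneSucc (P.d (i + 1)) (φ (i + 1)) (R.d i)
      root := P.root
      eq_root := P.eq_root
      shift_root := P.shift_root
      mem_range_zero := fun v => by
        constructor
        · rintro ⟨w, rfl⟩
          rw [coneZero_apply, Pi.add_apply]
          refine Ideal.add_mem _ (Ideal.mem_sup_left ((P.mem_range_zero _).1 ⟨_, rfl⟩))
            (Ideal.mem_sup_right ?_)
          rw [hφ₀]
          exact Ideal.mem_span_singleton'.2 ⟨_, mul_comm _ _⟩
        · intro h
          obtain ⟨y, hy, z, hz, hyz⟩ := Submodule.mem_sup.1 h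
          obtain ⟨x, rfl⟩ := Ideal.mem_span_singleton'.1 hz
          obtain ⟨p, hp⟩ := (P.mem_range_zero (fun _ => y)).2 hy
          refine ⟨Sum.elim p (fun _ => x), ?_⟩
          rw [coneZero_apply, Sum.elim_comp_inl, Sum.elim_comp_inr, hp]
          funext a
          rw [P.eq_root a, Pi.add_apply, hφ₀, ← hyz, mul_comm]
      homog := fun i => by
        cases i with
        | zero => exact homogMap_coneZero (P.homog 0) (hφh 0)
        | succ i => exact homogMap_coneSucc (P.homog _) (hφh _) ((R.homog i).add_const c)
      exact := fun i => by
        cases i with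
        | zero =>
          intro v
          dsimp only
          rw [coneZero_apply]
          constructor
          · intro hv
            -- The colon condition enters here: in a cycle, `u` times the `R`-component lies in `J`.
            have h1 : v (Sum.inr R.root) ∈ Q := by
              rw [hQ]
              have h2 : P.d 0 (v ∘ Sum.inl) P.root ∈ J := (P.mem_range_zero _).1 ⟨_, rfl⟩
              have h3 := congrFun hv P.root
              rw [Pi.add_apply, hφ₀, Pi.zero_apply] at h3
              have h4 : u * v (Sum.inr R.root) = - P.d 0 (v ∘ Sum.inl) P.root :=
                eq_neg_of_add_eq_zero_right h3
              rw [h4]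
              exact J.neg_mem h2
            -- Since `q` bounds the `R`-component, adding `φ 1 q` to the `P`-component gives a cycle
            -- of `P`. If `p` bounds that cycle, then `(p, -q)` bounds `v`; the sign cancels the one
            -- in the cone.
            obtain ⟨q, hq⟩ := (R.mem_range_zero (v ∘ Sum.inr)).2 h1
            obtain ⟨p, hp⟩ := (P.exact 0 (v ∘ Sum.inl + φ 1 q)).1 (by
              rw [map_add, hφ, hq, hv])
            refine ⟨Sum.elim p (-q), ?_⟩
            rw [coneSucc_apply, Sum.elim_comp_inl, Sum.elim_comp_inr, hp, map_neg, map_neg, hq,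
              neg_neg, add_neg_cancel_right, Sum.elim_comp_inl_inr]
          · rintro ⟨w, rfl⟩
            rw [coneSucc_apply, Sum.elim_comp_inl, Sum.elim_comp_inr, map_add, map_neg, hφ,
              (P.exact 0).apply_apply_eq_zero]
            abel
        | succ i =>
          intro v
          dsimp only
          rw [coneSucc_apply]
          constructor
          · intro hv
            have hv1 : P.d (i + 1) (v ∘ Sum.inl) + φ (i + 1) (v ∘ Sum.inr) = 0 :=
              funext fun a => congrFun hv (Sum.inl a)
            have hv2 : R.d i (v ∘ Sum.inr) = 0 :=
              neg_eq_zero.1 (funext fun a => congrFun hv (Sum.inr a))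
            obtain ⟨q, hq⟩ := (R.exact i _).1 hv2
            obtain ⟨p, hp⟩ := (P.exact (i + 1) (v ∘ Sum.inl + φ (i + 2) q)).1 (by
              rw [map_add, hφ, hq, hv1])
            refine ⟨Sum.elim p (-q), ?_⟩
            rw [coneSucc_apply, Sum.elim_comp_inl, Sum.elim_comp_inr, hp, map_neg, map_neg, hq,
              neg_neg, add_neg_cancel_right, Sum.elim_comp_inl_inr]
          · rintro ⟨w, rfl⟩
            rw [coneSucc_apply, Sum.elim_comp_inl, Sum.elim_comp_inr, map_add, map_neg, map_neg,
              hφ, (P.exact (i + 1)).apply_apply_eq_zero, (R.exact i).apply_apply_eq_zero]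
            funext a
            cases a <;> simp
      minimal := fun i v a => by
        dsimp only
        rw [coneSucc_apply]
        cases a with
        | inl a =>
          rw [Sum.elim_inl, Pi.add_apply, map_add, P.minimal, hθ, add_zero]
        | inr a =>
          rw [Sum.elim_inr, Pi.neg_apply, map_neg, hRmin, neg_zero] }
  refine ⟨C, fun i t => ?_, fun i b => ?_⟩
  · have h1 : C.betti (i + 1) t = (Finset.univ.filter fun b : P.ι (i + 1) ⊕ R.ι i =>
      Sum.elim (P.shift (i + 1)) (fun b => R.shift i b + c) b = t).card := rfl
    rw [h1, betti, betti]
    simp only [Finset.card_filter, Fintype.sum_sum_type, Sum.elim_inl, Sum.elim_inr,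
      eq_sub_iff_add_eq]
    rfl
  · rcases b with a | a
    · exact Or.inl ⟨a, rfl⟩
    · exact Or.inr ⟨a, rfl⟩

theorem betti_zero {I : Ideal S} (C : QuotientResolution I) (t : ℤ) :
    C.betti 0 t = if t = 0 then 1 else 0 := by
  have : ∀ b, C.shift 0 b = 0 := fun b => by rw [C.eq_root b, C.shift_root]
  simp only [betti, this]
  split_ifs with h
  · subst h
    simp only [Finset.filter_true, Finset.card_univ]
    exact Fintype.card_eq_one_iff.2 ⟨C.root, C.eq_root⟩
  · simp [Ne.symm h]

/-- A set of variables has a linear resolution with binomial Betti numbers. -/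
theorem exists_variables (T : Finset (Fin n)) :
    ∃ C : QuotientResolution (Ideal.span ((X : Fin n → S) '' T)),
      (∀ i b, C.shift i b = i) ∧
      ∀ (i : ℕ) (t : ℤ), C.betti i t = if t = i then T.card.choose i else 0 := by
  classical
  induction T using Finset.induction_on with
  | empty =>
    have h : Ideal.span ((X : Fin n → S) '' (∅ : Finset (Fin n))) = ⊥ := by simp
    rw [h]
    refine ⟨bot, fun i b => ?_, fun i t => ?_⟩
    · cases i with
      | zero => rfl
      | succ i => exact b.elim
    · cases i with
      | zero => simp [betti_zero]
      | succ i => simp [bot_betti_succ]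
  | insert x T hx ih =>
    obtain ⟨C, hC, hCb⟩ := ih
    -- A new variable is a nonzerodivisor modulo the old ones, so the colon ideal is the old ideal
    -- itself and `C` serves twice, as in the Koszul complex.
    obtain ⟨D, hDb, hD⟩ := exists_cone C C (X x) 1 (isHomogeneous_X _ _) (fun f => by
        constructor
        · exact fun h => Ideal.mul_mem_left _ _ h
        · intro h
          rw [mem_ideal_span_X_image] at h ⊢
          intro m hm
          obtain ⟨i, hi, hne⟩ := h (Finsupp.single x 1 + m) (by
            rw [mem_support_iff, coeff_X_mul]
            exact mem_support_iff.1 hm)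
          refine ⟨i, hi, ?_⟩
          have hix : x ≠ i := by
            rintro rfl
            exact hx hi
          simpa [Finsupp.single_eq_of_ne' hix] using hne)
      (fun f hf => by
        rw [mem_ideal_span_X_image] at hf
        by_contra h
        obtain ⟨i, -, hi⟩ := hf 0 (by rwa [mem_support_iff, ← constantCoeff_eq])
        exact hi rfl)
      (fun i a b => by rw [hC, hC]; simp)
    have hI : Ideal.span ((X : Fin n → S) '' T) ⊔ Ideal.span {X x} =
        Ideal.span ((X : Fin n → S) '' (insert x T : Finset (Fin n))) := by
      rw [← Ideal.span_union, Finset.coe_insert, Set.image_insert_eq, Set.union_singleton]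
    rw [← hI]
    refine ⟨D, fun i b => ?_, fun i t => ?_⟩
    · cases i with
      | zero => rw [D.eq_root b, D.shift_root]; rfl
      | succ i =>
        rcases hD i b with ⟨a, ha⟩ | ⟨a, ha⟩
        · rw [ha, hC]
        · rw [ha, hC]; push_cast; rfl
    · cases i with
      | zero => simp [betti_zero]
      | succ i =>
        rw [hDb, hCb, hCb, Finset.card_insert_of_notMem hx, Nat.choose_succ_succ]
        have : t - ((1 : ℕ) : ℤ) = i ↔ t = ((i + 1 : ℕ) : ℤ) := by
          push_cast
          constructor <;> intro h <;> linarith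
        simp only [this]
        split_ifs
        · exact add_comm _ _
        · rfl

end QuotientResolution

/-! ### Monomial generators, Borel moves and linear quotients. -/

theorem mem_minGens {I : Ideal S} {u : Fin n →₀ ℕ} :
    u ∈ minGens I ↔ Minimal (fun v => monomial v (1 : K) ∈ I) u := by
  simp [minGens, minGenSet]

theorem exists_minGens_le {I : Ideal S} {v : Fin n →₀ ℕ} (hv : monomial v (1 : K) ∈ I) :
    ∃ u ∈ minGens I, u ≤ v := by
  obtain ⟨u, huv, hu⟩ := exists_minimal_le_of_wellFoundedLT (fun v => monomial v (1 : K) ∈ I) v hv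
  exact ⟨u, mem_minGens.2 hu, huv⟩

theorem exists_le_of_monomial_mem_span {A : Set (Fin n →₀ ℕ)} {u : Fin n →₀ ℕ}
    (hu : monomial u (1 : K) ∈ Ideal.span ((fun u => monomial u (1 : K)) '' A)) :
    ∃ a ∈ A, a ≤ u := by
  classical
  rw [mem_ideal_span_monomial_image] at hu
  exact hu u (by simp [support_monomial])

theorem IsBoundedMonomialIdeal.isBounded {I : Ideal S} (hI : IsBoundedMonomialIdeal k I)
    {u : Fin n →₀ ℕ} (hu : u ∈ minGens I) : IsBounded k u := by
  obtain ⟨A, hA, rfl⟩ := hI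
  rw [mem_minGens] at hu
  obtain ⟨a, ha, hau⟩ := exists_le_of_monomial_mem_span hu.prop
  have h := hu.le_of_le (Ideal.subset_span ⟨a, ha, rfl⟩) hau
  rw [le_antisymm h hau]
  exact hA a ha

theorem IsBoundedMonomialIdeal.span_minGens {I : Ideal S} (hI : IsBoundedMonomialIdeal k I) :
    Ideal.span ((fun u => monomial u (1 : K)) '' (minGens I : Set (Fin n →₀ ℕ))) = I := by
  apply le_antisymm
  · rw [Ideal.span_le]
    rintro _ ⟨u, hu, rfl⟩
    exact (mem_minGens.1 hu).prop
  · obtain ⟨A, hA, rfl⟩ := hI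
    refine Ideal.span_le.2 ?_
    rintro _ ⟨a, ha, rfl⟩
    obtain ⟨u, hu, hua⟩ := exists_minGens_le
      (Ideal.subset_span ⟨a, ha, rfl⟩ :
        monomial a (1 : K) ∈ Ideal.span ((fun u => monomial u (1 : K)) '' A))
    rw [SetLike.mem_coe, mem_ideal_span_monomial_image]
    intro m hm
    rw [Finset.mem_singleton.1 (support_monomial_subset hm)]
    exact ⟨u, hu, hua⟩

/-- The weight `∑ ℓ u_ℓ` of the exponent vector `u`. -/
abbrev wt : (Fin n →₀ ℕ) →+ ℕ := Finsupp.weight fun i : Fin n => (i : ℕ)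

theorem wt_mono {u v : Fin n →₀ ℕ} (h : u ≤ v) : wt u ≤ wt v := by
  obtain ⟨w, rfl⟩ := exists_add_of_le h
  rw [map_add]
  exact Nat.le_add_right _ _

theorem le_maxIndex {u : Fin n →₀ ℕ} {i : Fin n} (hi : u i ≠ 0) : (i : ℕ) + 1 ≤ maxIndex u :=
  Finset.le_sup (f := fun i : Fin n => (i : ℕ) + 1) (Finsupp.mem_support_iff.2 hi)

theorem exists_maxIndex_eq {u : Fin n →₀ ℕ} (h : 0 < maxIndex u) :
    ∃ j, u j ≠ 0 ∧ (j : ℕ) + 1 = maxIndex u := by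
  have hne : u.support.Nonempty := by
    rw [Finset.nonempty_iff_ne_empty]
    intro h0
    simp [maxIndex, h0] at h
  obtain ⟨j, hj, hj'⟩ := Finset.exists_mem_eq_sup _ hne fun i : Fin n => (i : ℕ) + 1
  exact ⟨j, Finsupp.mem_support_iff.1 hj, hj'.symm⟩

/-- The Borel move `v ↦ x_i (v / x_j)` keeps the degree and lowers the weight. -/
theorem borelMove {v : Fin n →₀ ℕ} {i j : Fin n} (hj : v j ≠ 0) (hij : i < j) :
    (Finsupp.single i 1 + (v - Finsupp.single j 1)).degree = v.degree ∧
      wt (Finsupp.single i 1 + (v - Finsupp.single j 1)) < wt v := by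
  obtain ⟨w, rfl⟩ := exists_add_of_le
    (Finsupp.single_le_iff.2 (Nat.one_le_iff_ne_zero.2 hj) : Finsupp.single j 1 ≤ v)
  rw [add_tsub_cancel_left]
  simp only [map_add, Finsupp.degree_single, Finsupp.weight_single, smul_eq_mul, one_mul, true_and]
  exact Nat.add_lt_add_right hij _

theorem borelMove_apply_le {v : Fin n →₀ ℕ} {i j l : Fin n} (hli : l ≠ i) :
    (Finsupp.single i 1 + (v - Finsupp.single j 1) : Fin n →₀ ℕ) l ≤ v l := by
  rw [Finsupp.add_apply, Finsupp.single_eq_of_ne hli, zero_add, Finsupp.tsub_apply]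
  exact Nat.sub_le _ _

theorem borelMove_apply_self {v : Fin n →₀ ℕ} {i j : Fin n} (hij : i ≠ j) :
    (Finsupp.single i 1 + (v - Finsupp.single j 1) : Fin n →₀ ℕ) i = v i + 1 := by
  simp [Finsupp.single_eq_of_ne hij, add_comm]

/-- A `k`-bounded monomial `v` of a `k`-Borel ideal whose exponents below `m(u)` are at most those
of `u` and with `deg v ≤ deg u` can be moved to a divisor of `u`. -/
theorem IsKBorel.exists_le {I : Ideal S} (hI : IsKBorel k I) {u : Fin n →₀ ℕ}
    (hu : IsBounded k u) {v : Fin n →₀ ℕ} (hv : IsBounded k v) (hvI : monomial v (1 : K) ∈ I)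
    (hlow : ∀ l : Fin n, (l : ℕ) + 1 < maxIndex u → v l ≤ u l) (hdeg : v.degree ≤ u.degree) :
    ∃ w ≤ u, monomial w (1 : K) ∈ I ∧ w.degree = v.degree := by
  induction hN : wt v using Nat.strong_induction_on generalizing v with
  | _ N ih =>
    by_cases hvu : v ≤ u
    · exact ⟨v, hvu, hvI, rfl⟩
    obtain ⟨j, hj⟩ : ∃ j, u j < v j := by
      by_contra! h
      exact hvu h
    obtain ⟨i, hi⟩ : ∃ i, v i < u i := by
      by_contra! h
      refine absurd hdeg (not_le.2 ?_)
      rw [Finsupp.degree_eq_sum, Finsupp.degree_eq_sum]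
      exact Finset.sum_lt_sum (fun l _ => h l) ⟨j, Finset.mem_univ _, hj⟩
    -- As `u i > 0`, the position `i` is at most `m(u)`, while `hlow` forces `j` to be at least
    -- `m(u)`. So `x_i (v / x_j)` is a Borel move; it stays bounded because `v i < u i ≤ k`, and it
    -- lowers the weight.
    have h1 := le_maxIndex (u := u) (i := i) (by omega)
    have h2 : ¬ (j : ℕ) + 1 < maxIndex u := fun h => absurd (hlow j h) (by omega)
    have hne : i ≠ j := by
      rintro rfl
      omega
    have hij : i < j := lt_of_le_of_ne (Fin.le_def.2 (by omega)) hne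
    obtain ⟨hd, hw⟩ := borelMove (v := v) (by omega : v j ≠ 0) hij
    have hb : IsBounded k (Finsupp.single i 1 + (v - Finsupp.single j 1)) := by
      intro l
      rcases eq_or_ne l i with rfl | hl
      · rw [borelMove_apply_self hne]
        exact (Nat.succ_le_of_lt hi).trans (hu l)
      · exact (borelMove_apply_le hl).trans (hv l)
    obtain ⟨w, hwu, hwI, hwd⟩ := ih _ (hN ▸ hw) hb
      (hI.2 v hv hvI j (Finsupp.mem_support_iff.2 (by omega)) i hij hb)
      (fun l hl => by
        rcases eq_or_ne l i with rfl | hli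
        · rw [borelMove_apply_self hne]
          exact hi
        · exact (borelMove_apply_le hli).trans (hlow l hl))
      (hd.trans_le hdeg) rfl
    exact ⟨w, hwu, hwI, hwd.trans hd⟩

/-- Monomials are ordered by degree and then by weight. -/
def key (u : Fin n →₀ ℕ) : ℕ ×ₗ ℕ := toLex (u.degree, wt u)

theorem key_lt_iff {u v : Fin n →₀ ℕ} :
    key u < key v ↔ u.degree < v.degree ∨ u.degree = v.degree ∧ wt u < wt v :=
  Prod.Lex.toLex_lt_toLex

theorem key_le_iff {u v : Fin n →₀ ℕ} :
    key u ≤ key v ↔ u.degree < v.degree ∨ u.degree = v.degree ∧ wt u ≤ wt v :=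
  Prod.Lex.toLex_le_toLex

/-- The variables `x_ℓ` with `ℓ < m(u)` whose exponent in `u` is less than `k`. -/
def freeVars (k : ℕ) (u : Fin n →₀ ℕ) : Finset (Fin n) :=
  Finset.univ.filter fun i : Fin n => (i : ℕ) + 1 < maxIndex u ∧ u i < k

/-- For bounded `u`, an exponent different from `k` is less than `k`. When `u = 1` both sides are
zero by truncated subtraction, which gives the convention `choose 0 i`. -/
theorem card_freeVars {u : Fin n →₀ ℕ} (hu : IsBounded k u) :
    (freeVars k u).card = maxIndex u - fullCount k u - 1 := by
  have hle : maxIndex u ≤ n := Finset.sup_le fun i _ => i.isLt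
  have h1 : (Finset.univ.filter fun i : Fin n => (i : ℕ) + 1 < maxIndex u).card =
      maxIndex u - 1 := by
    have : (Finset.univ.filter fun i : Fin n => (i : ℕ) + 1 < maxIndex u) =
        (Finset.univ.filter fun i : Fin n => (i : ℕ) < maxIndex u - 1) := by
      ext i
      simp only [Finset.mem_filter, Finset.mem_univ, true_and]
      omega
    rw [this, Fin.card_filter_val_lt]
    omega
  have h2 := Finset.card_filter_add_card_filter_not
    (s := Finset.univ.filter fun i : Fin n => (i : ℕ) + 1 < maxIndex u) (fun i => u i = k)
  rw [Finset.filter_filter, Finset.filter_filter, h1] at h2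
  have h3 : (Finset.univ.filter fun i : Fin n => (i : ℕ) + 1 < maxIndex u ∧ ¬ u i = k) =
      freeVars k u := by
    ext i
    have := hu i
    simp only [freeVars, Finset.mem_filter, Finset.mem_univ, true_and]
    omega
  rw [h3] at h2
  rw [fullCount]
  omega

/-- If `v` comes before `u` in the order by degree and weight and no exponent of `v` below `m(u)`
exceeds that of `u`, and the degrees agree, then `u` and `v` are comparable. -/
theorem le_or_le_of_wt_le {u v : Fin n →₀ ℕ}
    (hlow : ∀ l : Fin n, (l : ℕ) + 1 < maxIndex u → v l ≤ u l) (hdeg : v.degree = u.degree)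
    (hwt : wt v ≤ wt u) : v ≤ u ∨ u ≤ v := by
  -- Below `m(u)` both factors are nonpositive, and above it `u l = 0`. With equal degrees the terms
  -- sum to `wt v - wt u ≤ 0`, so each vanishes and `u`, `v` agree except possibly at `m(u)`.
  have hterm : ∀ l : Fin n, 0 ≤ ((l : ℤ) + 1 - maxIndex u) * ((v l : ℤ) - u l) := by
    intro l
    rcases lt_trichotomy ((l : ℕ) + 1) (maxIndex u) with h | h | h
    · have := hlow l h
      exact mul_nonneg_of_nonpos_of_nonpos (by omega) (by omega)
    · rw [← h]
      simp
    · have : u l = 0 := by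
        by_contra h0
        have := le_maxIndex h0
        omega
      exact mul_nonneg (by omega) (by omega)
  have hsum : ∑ l : Fin n, ((l : ℤ) + 1 - maxIndex u) * ((v l : ℤ) - u l) ≤ 0 := by
    have e : ∑ l : Fin n, ((l : ℤ) + 1 - maxIndex u) * ((v l : ℤ) - u l) =
        ((wt v : ℕ) - (wt u : ℕ) : ℤ) +
          (1 - maxIndex u) * ((v.degree : ℕ) - (u.degree : ℕ) : ℤ) := by
      simp only [wt, Finsupp.weight_eq_sum, Finsupp.degree_eq_sum, smul_eq_mul]
      push_cast
      rw [← Finset.sum_sub_distrib, ← Finset.sum_sub_distrib, Finset.mul_sum,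
        ← Finset.sum_add_distrib]
      exact Finset.sum_congr rfl fun l _ => by ring
    rw [e, hdeg]
    simpa using hwt
  have hzero := (Finset.sum_eq_zero_iff_of_nonneg fun l _ => hterm l).1
    (le_antisymm hsum (Finset.sum_nonneg fun l _ => hterm l))
  have heq : ∀ l : Fin n, (l : ℕ) + 1 ≠ maxIndex u → v l = u l := by
    intro l hl
    rcases mul_eq_zero.1 (hzero l (Finset.mem_univ _)) with h | h <;> omega
  by_cases hj : ∃ j : Fin n, (j : ℕ) + 1 = maxIndex u
  · obtain ⟨j, hj⟩ := hj
    have hother : ∀ l, l ≠ j → v l = u l := fun l hl => heq l fun h => hl (Fin.ext (by omega))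
    rcases le_total (v j) (u j) with h | h
    · exact Or.inl fun l => if hl : l = j then hl ▸ h else (hother l hl).le
    · exact Or.inr fun l => if hl : l = j then hl ▸ h else (hother l hl).ge
  · exact Or.inl fun l => (heq l fun h => hj ⟨l, h⟩).le

/-- The minimal generators of a `k`-Borel ideal, ordered by degree and weight, have linear
quotients. -/
theorem IsKBorel.mem_span_freeVars_iff {I : Ideal S} (hI : IsKBorel k I)
    {s : Finset (Fin n →₀ ℕ)} (hs : s ⊆ minGens I) {u : Fin n →₀ ℕ} (hu : u ∈ minGens I)
    (hus : u ∉ s) (hle : ∀ v ∈ s, key v ≤ key u) (hlt : ∀ v ∈ minGens I, key v < key u → v ∈ s)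
    (f : S) : f ∈ Ideal.span ((X : Fin n → S) '' freeVars k u) ↔
      monomial u 1 * f ∈ Ideal.span ((fun u => monomial u (1 : K)) '' (s : Set (Fin n →₀ ℕ))) := by
  classical
  have hub := hI.1.isBounded hu
  rw [mem_ideal_span_X_image, mem_ideal_span_monomial_image]
  constructor
  · intro h m hm
    obtain ⟨x, hx, y, hy, rfl⟩ := Finset.mem_add.1 (support_mul _ _ hm)
    obtain rfl := Finset.mem_singleton.1 (support_monomial_subset hx)
    obtain ⟨i, hi, hne⟩ := h y hy
    obtain ⟨him, hik⟩ : (i : ℕ) + 1 < maxIndex x ∧ x i < k := by simpa [freeVars] using hi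
    obtain ⟨j, hj, hjm⟩ := exists_maxIndex_eq (u := x) (by omega)
    have hij : i < j := Fin.lt_def.2 (by omega)
    have hb : IsBounded k (Finsupp.single i 1 + (x - Finsupp.single j 1)) := by
      intro l
      rcases eq_or_ne l i with rfl | hl
      · rw [borelMove_apply_self hij.ne]
        exact hik
      · exact (borelMove_apply_le hl).trans (hub l)
    -- A generator `w` dividing `x_i (u / x_j)`, with `j` the last variable of `u`, has smaller key
    -- than `u` and divides `x_i u`.
    obtain ⟨w, hw, hwle⟩ := exists_minGens_le
      (hI.2 x hub (mem_minGens.1 hu).prop j (Finsupp.mem_support_iff.2 hj) i hij hb)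
    obtain ⟨hd, hwt⟩ := borelMove hj hij
    refine ⟨w, hlt w hw ?_, hwle.trans ?_⟩
    · have h1 := Finsupp.degree_mono hwle
      have h2 := wt_mono hwle
      rw [key_lt_iff]
      omega
    · rw [add_comm]
      exact add_le_add tsub_le_self (Finsupp.single_le_iff.2 (Nat.one_le_iff_ne_zero.2 hne))
  · intro h m hm
    obtain ⟨v, hv, hvle⟩ := h (u + m) (by
      rw [mem_support_iff, coeff_monomial_mul, one_mul]
      exact mem_support_iff.1 hm)
    have hvG := hs hv
    have hvb := hI.1.isBounded hvG
    by_contra! hcon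
    -- Below `m(u)`, either `x_l` is free and does not occur in `m`, or the exponent of `u` is
    -- already `k`, which bounds that of `v`.
    have hlow : ∀ l : Fin n, (l : ℕ) + 1 < maxIndex u → v l ≤ u l := by
      intro l hl
      rcases lt_or_ge (u l) k with hk | hk
      · have h0 := hcon l (by simp [freeVars, hl, hk])
        have := hvle l
        rwa [Finsupp.add_apply, h0, add_zero] at this
      · exact (hvb l).trans hk
    -- In smaller degree, Borel moves turn `v` into a proper divisor of `u` in `I`; in equal degree,
    -- `u` and `v` are comparable. Both contradict minimality or `u ∉ s`.
    rcases key_le_iff.1 (hle v hv) with hd | ⟨hd, hwt⟩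
    · obtain ⟨w, hwu, hwI, hwd⟩ := hI.exists_le hub hvb (mem_minGens.1 hvG).prop hlow hd.le
      have := Finsupp.degree_mono ((mem_minGens.1 hu).le_of_le hwI hwu)
      omega
    · have huv : v = u := by
        rcases le_or_le_of_wt_le hlow hd hwt with h1 | h1
        · exact le_antisymm h1 ((mem_minGens.1 hu).le_of_le (mem_minGens.1 hvG).prop h1)
        · exact le_antisymm ((mem_minGens.1 hvG).le_of_le (mem_minGens.1 hu).prop h1) h1
      exact hus (huv ▸ hv)

/-! ### The resolution of a `k`-Borel ideal by iterated cones. -/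

theorem IsKBorel.exists_quotientResolution_span {I : Ideal S} (hI : IsKBorel k I)
    (s : Finset (Fin n →₀ ℕ)) (hs : s ⊆ minGens I)
    (hlt : ∀ u ∈ s, ∀ v ∈ minGens I, key v < key u → v ∈ s) :
    ∃ C : QuotientResolution
        (Ideal.span ((fun u => monomial u (1 : K)) '' (s : Set (Fin n →₀ ℕ)))),
      (∀ (i : ℕ) (t : ℤ), C.betti (i + 1) t =
        ∑ u ∈ s, if t - (u.degree : ℕ) = i then (freeVars k u).card.choose i else 0) ∧
      ∀ i b, ∃ u ∈ s, C.shift (i + 1) b = i + (u.degree : ℕ) := by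
  classical
  induction s using Finset.induction_on_max_value key with
  | empty =>
    have h : Ideal.span ((fun u => monomial u (1 : K)) ''
        ((∅ : Finset (Fin n →₀ ℕ)) : Set (Fin n →₀ ℕ))) = ⊥ := by simp
    rw [h]
    exact ⟨QuotientResolution.bot, fun i t => by simp [QuotientResolution.bot_betti_succ],
      fun i b => b.elim⟩
  | insert u s hus hmax ih =>
    have hs' : s ⊆ minGens I := (Finset.subset_insert _ _).trans hs
    have huG := hs (Finset.mem_insert_self u s)
    obtain ⟨P, hPb, hP⟩ := ih hs' fun w hw v hv hvw => by
      rcases Finset.mem_insert.1 (hlt w (Finset.mem_insert_of_mem hw) v hv hvw) with rfl | h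
      · exact absurd (hmax w hw) (not_le.2 hvw)
      · exact h
    obtain ⟨R, hR, hRb⟩ := QuotientResolution.exists_variables (K := K) (freeVars k u)
    obtain ⟨C, hCb, hC⟩ := QuotientResolution.exists_cone P R (monomial u 1) u.degree
      (isHomogeneous_monomial _ rfl)
      (hI.mem_span_freeVars_iff hs' huG hus hmax fun v hv hvu => by
        rcases Finset.mem_insert.1 (hlt u (Finset.mem_insert_self u s) v hv hvu) with rfl | h
        · exact absurd hvu (lt_irrefl _)
        · exact h)
      (fun f hf => by
        rw [mem_ideal_span_X_image] at hf
        by_contra h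
        obtain ⟨i, -, hi⟩ := hf 0 (by rwa [mem_support_iff, ← constantCoeff_eq])
        exact hi rfl)
      -- The shift `i + deg v` is less than `(i + 1) + deg u`, since `deg v ≤ deg u`; this is the
      -- minimality condition for the cone.
      (fun i a b => by
        obtain ⟨v, hv, hv'⟩ := hP i a
        rw [hv', hR]
        rcases key_le_iff.1 (hmax v hv) with h | h <;> push_cast <;> omega)
    have hspan : Ideal.span ((fun u => monomial u (1 : K)) '' (s : Set (Fin n →₀ ℕ))) ⊔
        Ideal.span {monomial u 1} = Ideal.span ((fun u => monomial u (1 : K)) ''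
          ((insert u s : Finset (Fin n →₀ ℕ)) : Set (Fin n →₀ ℕ))) := by
      rw [← Ideal.span_union, Finset.coe_insert, Set.image_insert_eq, Set.union_singleton]
    rw [← hspan]
    refine ⟨C, fun i t => ?_, fun i b => ?_⟩
    · rw [hCb, hPb, hRb, Finset.sum_insert hus, add_comm]
    · rcases hC i b with ⟨a, ha⟩ | ⟨a, ha⟩
      · obtain ⟨v, hv, hv'⟩ := hP i a
        exact ⟨v, Finset.mem_insert_of_mem hv, ha.trans hv'⟩
      · exact ⟨u, Finset.mem_insert_self _ _, by rw [ha, hR]⟩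

theorem IsKBorel.exists_quotientResolution {I : Ideal S} (hI : IsKBorel k I) :
    ∃ C : QuotientResolution I, ∀ (i : ℕ) (j : ℤ), C.betti (i + 1) (i + j) =
      ∑ u ∈ (minGens I).filter (fun u => ((Finsupp.degree u : ℕ) : ℤ) = j),
        (maxIndex u - fullCount k u - 1).choose i := by
  obtain ⟨C, hC, -⟩ := hI.exists_quotientResolution_span (minGens I) subset_rfl
    fun _ _ v hv _ => hv
  -- The ideal is a parameter of the type of resolutions, so the equality is eliminated with `J` as
  -- a variable.
  have key : ∀ J, Ideal.span ((fun u => monomial u (1 : K)) ''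
      (minGens I : Set (Fin n →₀ ℕ))) = J →
      ∃ D : QuotientResolution J, ∀ i t, D.betti i t = C.betti i t := by
    rintro _ rfl
    exact ⟨C, fun _ _ => rfl⟩
  obtain ⟨D, hD⟩ := key I hI.1.span_minGens
  refine ⟨D, fun i j => ?_⟩
  rw [hD, hC, Finset.sum_filter]
  refine Finset.sum_congr rfl fun u hu => ?_
  have h : (i : ℤ) + j - (u.degree : ℕ) = i ↔ ((u.degree : ℕ) : ℤ) = j := by
    constructor <;> intro h <;> linarith
  simp only [h, card_freeVars (hI.1.isBounded hu)]

/-! ### Passage between resolutions of `I` and of `S ⧸ I`. -/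

theorem constantCoeff_eq_zero_iff_mem {p : S} :
    constantCoeff p = 0 ↔ p ∈ Ideal.span (Set.range (X : Fin n → S)) := by
  rw [← Set.image_univ, mem_ideal_span_X_image]
  constructor
  · intro h m hm
    by_contra! hcon
    have : m = 0 := Finsupp.ext fun i => hcon i (Set.mem_univ i)
    rw [this, mem_support_iff, ← constantCoeff_eq] at hm
    exact hm h
  · intro h
    by_contra h0
    obtain ⟨i, -, hi⟩ := h 0 (by rwa [mem_support_iff, ← constantCoeff_eq])
    exact hi rfl

theorem mem_smul_top_iff_constantCoeff {α : Type} [Fintype α] {v : α → S} :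
    v ∈ Ideal.span (Set.range (X : Fin n → S)) • (⊤ : Submodule S (α → S)) ↔
      ∀ a, constantCoeff (v a) = 0 := by
  classical
  constructor
  · intro h a
    refine Submodule.smul_induction_on h (fun r hr w _ => ?_) (fun x y hx hy => ?_)
    · rw [Pi.smul_apply, smul_eq_mul, map_mul, constantCoeff_eq_zero_iff_mem.2 hr, zero_mul]
    · rw [Pi.add_apply, map_add, hx, hy, add_zero]
  · intro h
    rw [pi_eq_sum_univ v]
    exact Submodule.sum_mem _ fun a _ =>
      Submodule.smul_mem_smul (constantCoeff_eq_zero_iff_mem.1 (h a)) Submodule.mem_top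

/-- Extend a minimal resolution of `I` by `I → S`. -/
def MinimalGradedFreeResolution.toQuotientResolution {I : Ideal S}
    (F : MinimalGradedFreeResolution I) : QuotientResolution I where
  ι i := Nat.casesOn i Unit fun i => Fin (F.rank i)
  fintype i := match i with
    | 0 => inferInstanceAs (Fintype Unit)
    | i + 1 => inferInstanceAs (Fintype (Fin (F.rank i)))
  shift i := match i with
    | 0 => fun _ => 0
    | i + 1 => F.shift i
  d i := match i with
    | 0 => LinearMap.pi fun _ => I.subtype ∘ₗ F.aug
    | i + 1 => F.d i
  root := ()
  eq_root _ := rfl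
  shift_root := rfl
  mem_range_zero v := by
    constructor
    · rintro ⟨w, rfl⟩
      exact (F.aug w).2
    · intro h
      obtain ⟨w, hw⟩ := F.aug_surjective ⟨_, h⟩
      exact ⟨w, funext fun _ => congrArg Subtype.val hw⟩
  homog i := by
    cases i with
    | zero =>
      refine homogMap_of_single (α := Fin (F.rank 0)) (β := Unit) fun b _ w hw => ?_
      have := F.aug_homogeneous b w hw
      simpa using this
    | succ i => exact homogMap_of_single (F.d_homogeneous i)
  exact i := by
    cases i with
    | zero =>
      intro v
      refine Iff.trans ?_ (F.exact_zero v)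
      exact ⟨fun h => Subtype.ext (congrFun h ()), fun h => funext fun _ => congrArg Subtype.val h⟩
    | succ i => exact F.exact_succ i
  minimal i v := mem_smul_top_iff_constantCoeff.1 (F.minimal i ⟨v, rfl⟩)

theorem MinimalGradedFreeResolution.betti_toQuotientResolution {I : Ideal S}
    (F : MinimalGradedFreeResolution I) (i : ℕ) (t : ℤ) :
    F.toQuotientResolution.betti (i + 1) t = F.betti i t := rfl

/-- Drop the module in degree zero, reindex the bases by `Fin`, and read the first differential as a
surjection onto `I`. -/
theorem QuotientResolution.nonempty_minimalGradedFreeResolution {I : Ideal S}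
    (C : QuotientResolution I) : Nonempty (MinimalGradedFreeResolution I) := by
  classical
  let e : ∀ i, Fin (Fintype.card (C.ι i)) ≃ C.ι i := fun i => (Fintype.equivFin _).symm
  let L : ∀ i, (C.ι i → S) ≃ₗ[S] (Fin (Fintype.card (C.ι i)) → S) :=
    fun i => LinearEquiv.funCongrLeft S S (e i)
  have hL : ∀ i v b, L i v b = v (e i b) := fun i v b => rfl
  have hLs : ∀ i b, (L i).symm (Pi.single b 1) = Pi.single (e i b) 1 := by
    intro i b
    rw [LinearEquiv.symm_apply_eq]
    funext c
    rw [hL, Pi.single_apply, Pi.single_apply, (e i).injective.eq_iff]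
    congr
  refine ⟨{
    rank := fun i => Fintype.card (C.ι (i + 1))
    shift := fun i b => C.shift (i + 1) (e (i + 1) b)
    aug := LinearMap.codRestrict I (LinearMap.proj C.root ∘ₗ C.d 0 ∘ₗ (L 1).symm.toLinearMap)
      fun v => (C.mem_range_zero _).1 ⟨_, rfl⟩
    d := fun i => (L (i + 1)).toLinearMap ∘ₗ C.d (i + 1) ∘ₗ (L (i + 2)).symm.toLinearMap
    aug_homogeneous := fun b w hw => ?_
    d_homogeneous := fun i b c w hw => ?_
    aug_surjective := fun f => ?_
    exact_zero := fun v => ?_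
    exact_succ := fun i v => ?_
    minimal := fun i => ?_ }⟩
  · have h := (C.homog 0).homogVec (homogVec_single (e 1 b)) C.root w (by
      rw [← hLs]; exact hw)
    rwa [C.shift_root, add_zero] at h
  · exact (C.homog (i + 1)).homogVec (homogVec_single (e (i + 2) b)) (e (i + 1) c) w (by
      rw [← hLs]; exact hw)
  · obtain ⟨w, hw⟩ := (C.mem_range_zero fun _ => f).2 f.2
    refine ⟨L 1 w, Subtype.ext ?_⟩
    change C.d 0 ((L 1).symm (L 1 w)) C.root = f
    rw [LinearEquiv.symm_apply_apply, hw]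
  · have h1 : C.d 0 ((L 1).symm v) = 0 ↔ _ := C.exact 0 _
    have h2 : C.d 0 ((L 1).symm v) = 0 ↔ C.d 0 ((L 1).symm v) C.root = 0 :=
      ⟨fun h => by rw [h]; rfl, fun h => funext fun a => by rw [C.eq_root a, h]; rfl⟩
    rw [Subtype.ext_iff]
    refine Iff.trans (h2.symm.trans h1) ⟨?_, ?_⟩
    · rintro ⟨w, hw⟩
      refine ⟨L 2 w, ?_⟩
      change L 1 (C.d 1 ((L 2).symm (L 2 w))) = v
      rw [LinearEquiv.symm_apply_apply, hw, LinearEquiv.apply_symm_apply]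
    · rintro ⟨w, rfl⟩
      exact ⟨(L 2).symm w, ((L 1).symm_apply_apply _).symm⟩
  · change L (i + 1) (C.d (i + 1) ((L (i + 2)).symm v)) = 0 ↔ _
    rw [LinearEquiv.map_eq_zero_iff, C.exact (i + 1) _]
    constructor
    · rintro ⟨w, hw⟩
      refine ⟨L (i + 3) w, ?_⟩
      change L (i + 2) (C.d (i + 2) ((L (i + 3)).symm (L (i + 3) w))) = v
      rw [LinearEquiv.symm_apply_apply, hw, LinearEquiv.apply_symm_apply]
    · rintro ⟨w, rfl⟩
      exact ⟨(L (i + 3)).symm w, ((L (i + 2)).symm_apply_apply _).symm⟩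
  · rintro _ ⟨v, rfl⟩
    exact mem_smul_top_iff_constantCoeff.2 fun a => C.minimal i _ _

end KBorel

end

theorem corollary2p3 {n : ℕ} {K : Type*} [Field K] {k : ℕ} (hk : 1 ≤ k)
    (I : Ideal (MvPolynomial (Fin n) K)) (hI : KBorel.IsKBorel k I) :
    Nonempty (KBorel.MinimalGradedFreeResolution I) ∧
      ∀ (F : KBorel.MinimalGradedFreeResolution I) (i : ℕ) (j : ℤ),
        F.betti i ((i : ℤ) + j) =
          ∑ u ∈ (KBorel.minGens I).filter (fun u => ((Finsupp.degree u : ℕ) : ℤ) = j),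
            (KBorel.maxIndex u - KBorel.fullCount k u - 1).choose i := by
  obtain ⟨C, hC⟩ := hI.exists_quotientResolution
  refine ⟨C.nonempty_minimalGradedFreeResolution, fun F i j => ?_⟩
  rw [← hC, ← F.betti_toQuotientResolution]
  exact KBorel.QuotientResolution.betti_eq _ _ _ _
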